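/- **Theorem (approximate stability of the $\ell_2$-radius for Čech filtrations).** *Conventions.* Homology is simplicial, unreduced, with $\mathbb{Z}_2$ coefficients. For a finite set $P\subset\mathbb{R}^n$ and $s\in\mathbb{R}$, let $\mathrm{Cech}_s(P)$ be the complex of all nonempty $X\subseteq P$ such that the closed balls of radius $s$ around the points of $X$ have a common point (it is empty for $s<0$), and let $\mathrm{Cech}(P)$ be the resulting filtration. Fix a degree $p\ge 0$. A *persistent $p$-basis* $\Omega^P=\{\zeta_i\}$ of $\mathrm{Cech}(P)$ is a finite family of intervals $[b_i,d_i)$, $b_i<d_i\le\infty$, together with $p$-cycles $\zeta_i$ of $\mathrm{Cech}_{b_i}(P)$ such that for every $s$ the classes $[\zeta_i]$ with $s\in[b_i,d_i)$ form a basis of $H_p(\mathrm{Cech}_s(P))$, and $[\zeta_i]=0$ in $H_p(\mathrm{Cech}_s(P))$ for $s\ge d_i$. The multiset of the bars $[b_i,d_i)$ is the barcode $B(\mathrm{Cech}(P))$. A *representative cycle* of a bar $[b,d)$ is a cycle that occurs in some persistent $p$-basis as the cycle of a bar $[b,d)$. For a chain $\xi$, $r(\xi)$ is the smallest radius of a Euclidean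 sphere enclosing all vertices of $\xi$, and $r([b,d))=\min r(\zeta)$ over all representative cycles $\zeta$ of $[b,d)$. For $\delta\ge 0$, a *$\delta$-approximate representative* of $[b,d)$ is a $p$-cycle $\zeta$ for which there are $b'\in[b-\delta,b+\delta]$ and $d'\in[d-\delta,d+\delta]$ ($d'=\infty$ if $d=\infty$), $b'<d'$, such that $\zeta$ is a cycle of the complex at time $s$ exactly when $s\ge b'$; the class of $\zeta$ in $H_p$ at time $b'$ is not in the image of $H_p$ at any time $s<b-\delta$; and, for $s\ge b'$, $\zeta$ is a boundary at time $s$ exactly when $s\ge d'$. Put $r^{\delta}([b,d))=\min r(\zeta)$ over all $\delta$-approximate representatives $\zeta$ of $[b,d)$. An *$\varepsilon$-matching* of two barcodes is a collection of pairs of bars in which every bar occurs at most once, such that matched bars $[b,d)$, $[b',d')$ satisfy $|b-b'|\le\varepsilon$ and $|d-d'|\le\varepsilon$ (with $|\infty-\infty|=0$), and unmatched bars have length at most $2\varepsilon$. *Statement.* Let $\varepsilon\ge 0$, let $P,Q\subset\mathbb{R}^n$ be finite and let $f\colon P\to Q$ be a bijection with $\|x-f(x)\|_2\le\varepsilon$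 for all $x\in P$; put $g=f^{-1}$. Then $\mathrm{Cech}(P)$ and $\mathrm{Cech}(Q)$ have persistent $p$-bases. For all persistent $p$-bases $\Omega^P=\{\zeta_i\}$ of $\mathrm{Cech}(P)$, with bars $[b_i,d_i)$, and $\Omega^Q=\{z_j\}$ of $\mathrm{Cech}(Q)$, with bars $[b'_j,d'_j)$, the following holds. 1. There is an $\varepsilon$-matching $\mathcal{M}$ between $B(\mathrm{Cech}(P))$ and $B(\mathrm{Cech}(Q))$ such that, whenever the $i$-th bar is matched to the $j$-th bar, the interval modules $\mathbb{I}^{[b_i,d_i)}$ and $\mathbb{I}^{[b'_j,d'_j)}$ are $\varepsilon$-interleaved, and either $[z_j]$ has nonzero coefficient in the expansion of $f_*[\zeta_i]\in H_p(\mathrm{Cech}_{b_i+\varepsilon}(Q))$ in the basis given by $\Omega^Q$, or $[\zeta_i]$ has nonzero coefficient in the expansion of $g_*[z_j]\in H_p(\mathrm{Cech}_{b'_j+\varepsilon}(P))$ in the basis given by $\Omega^P$. 2. For every such $\mathcal{M}$ and every matched pair $[b,d)\in B(\mathrm{Cech}(P))$, $[b',d')\in B(\mathrm{Cech}(Q))$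 with both lengths greater than $2\varepsilon$, $$r^{2\varepsilon}([b,d))\le r([b',d'))+\varepsilon\qquad\text{and}\qquad r^{2\varepsilon}([b',d'))\le r([b,d))+\varepsilon .$$ -/

import Mathlib

noncomputable section

/-! ### Simplicial homology with coefficients in the field with two elements -/

/-- Formal `ZMod 2`-combinations of finite vertex sets; a set with `p + 1` vertices is a
`p`-simplex. -/
abbrev SChain (V : Type) : Type := Finset V →₀ ZMod 2

open scoped Classical in
/-- The (unreduced) mod-2 boundary operator: a simplex with at least two vertices goes to the sum
of its facets, a vertex goes to zero. -/
def bdry (V : Type) : SChain V →ₗ[ZMod 2] SChain V :=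
  Finsupp.linearCombination (ZMod 2) (fun σ : Finset V =>
    if 2 ≤ σ.card then ∑ v ∈ σ, (Finsupp.single (σ.erase v) 1 : SChain V) else 0)

/-- The group `C_p(K)` of `p`-chains of the complex `K`. -/
def chains {V : Type} (K : PreAbstractSimplicialComplex V) (p : ℕ) :
    Submodule (ZMod 2) (SChain V) :=
  Finsupp.supported (ZMod 2) (ZMod 2) {σ : Finset V | σ ∈ K ∧ σ.card = p + 1}

/-- The group `Z_p(K)` of `p`-cycles. -/
def cycles {V : Type} (K : PreAbstractSimplicialComplex V) (p : ℕ) :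
    Submodule (ZMod 2) (SChain V) :=
  chains K p ⊓ LinearMap.ker (bdry V)

/-- The group `B_p(K)` of `p`-boundaries. -/
def boundaries {V : Type} (K : PreAbstractSimplicialComplex V) (p : ℕ) :
    Submodule (ZMod 2) (SChain V) :=
  (chains K (p + 1)).map (bdry V)

/-- The class of a chain modulo `B_p(K)`. -/
def homClass {V : Type} (K : PreAbstractSimplicialComplex V) (p : ℕ) :
    SChain V →ₗ[ZMod 2] (SChain V ⧸ boundaries K p) :=
  (boundaries K p).mkQ

/-- For `K ≤ L`, the image of `H_p(K) → H_p(L)`, where `H_p(L)` is realized as the subspace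
`Z_p(L) / B_p(L)` of the space of all chains modulo `B_p(L)`. -/
def homologyImage {V : Type} (K L : PreAbstractSimplicialComplex V) (p : ℕ) :
    Submodule (ZMod 2) (SChain V ⧸ boundaries L p) :=
  (cycles K p).map (homClass L p)

/-- The homology group `H_p(K) = Z_p(K) / B_p(K)`. -/
def homology {V : Type} (K : PreAbstractSimplicialComplex V) (p : ℕ) :
    Submodule (ZMod 2) (SChain V ⧸ boundaries K p) :=
  homologyImage K K p

/-- The chain map induced by an injective map of vertices. -/
def pushChain {V W : Type} (f : V ↪ W) : SChain V →ₗ[ZMod 2] SChain W :=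
  Finsupp.lmapDomain (ZMod 2) (ZMod 2) (fun σ : Finset V => σ.map f)

/-! ### Filtrations, barcodes and persistent bases -/

/-- A filtration indexed by the real numbers. -/
abbrev Filt (V : Type) : Type := ℝ →o PreAbstractSimplicialComplex V

/-- A persistent `p`-basis of a filtration: finitely many intervals `[birth i, death i)`, where
`death i = ⊤` is allowed, and for each of them a `p`-cycle that lives in the complex at time
`birth i`, such that `H_p` of the filtration is the internal direct sum of the interval modules
spanned by the classes of these cycles: at each time `s` the classes of the cycles that are alive
at `s` form a basis of the homology group, and a class becomes zero at the end of its interval.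
The multiset of these intervals is the barcode of the filtration in degree `p`. -/
structure PersistentBasis {V : Type} (F : Filt V) (p : ℕ) where
  ι : Type
  fin : Fintype ι
  birth : ι → ℝ
  death : ι → WithTop ℝ
  cycle : ι → SChain V
  birth_lt_death : ∀ i, (birth i : WithTop ℝ) < death i
  cycle_mem : ∀ i, cycle i ∈ cycles (F (birth i)) p
  cycle_dead : ∀ i (s : ℝ), death i ≤ (s : WithTop ℝ) → homClass (F s) p (cycle i) = 0
  linearIndependent : ∀ s : ℝ, LinearIndependent (ZMod 2)
    (fun i : {i : ι // birth i ≤ s ∧ (s : WithTop ℝ) < death i} =>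
      homClass (F s) p (cycle i.1))
  span_eq : ∀ s : ℝ, Submodule.span (ZMod 2)
    (Set.range (fun i : {i : ι // birth i ≤ s ∧ (s : WithTop ℝ) < death i} =>
      homClass (F s) p (cycle i.1))) = homology (F s) p

attribute [instance] PersistentBasis.fin

/-- The bar `i` has length greater than `l`. -/
def PersistentBasis.LongerThan {V : Type} {F : Filt V} {p : ℕ} (B : PersistentBasis F p)
    (l : ℝ) (i : B.ι) : Prop :=
  ((B.birth i + l : ℝ) : WithTop ℝ) < B.death i

/-- For a cycle `z` of `F s`: when the class of `z` is written in the basis of `H_p(F s)` given by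
the cycles of `B` that are alive at time `s`, the coefficient at `i` is nonzero. -/
def PersistentBasis.CoeffNonzero {V : Type} {F : Filt V} {p : ℕ} (B : PersistentBasis F p)
    (s : ℝ) (z : SChain V) (i : B.ι) : Prop :=
  ∃ c : B.ι → ZMod 2,
    (∀ k, c k ≠ 0 → B.birth k ≤ s ∧ (s : WithTop ℝ) < B.death k) ∧
    homClass (F s) p z = ∑ k, c k • homClass (F s) p (B.cycle k) ∧
    c i ≠ 0

/-- The set `R([b,d))` of representative cycles (persistent cycles) of a bar `[b,d)`: the cycles
that stand for a bar `[b,d)` in some persistent basis. -/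
def representatives {V : Type} (F : Filt V) (p : ℕ) (b : ℝ) (d : WithTop ℝ) :
    Set (SChain V) :=
  {z | ∃ (B : PersistentBasis F p) (i : B.ι), B.birth i = b ∧ B.death i = d ∧ B.cycle i = z}

/-- The `δ`-approximate representatives of `[b,d)`: cycles `z` that are born at some
`b' ∈ [b - δ, b + δ]`, die at some `d' ∈ [d - δ, d + δ]`, and whose class is nontrivial on
`[b', d')`. Being born is read in the strong sense: `b'` is the time at which `z` enters the
filtration, and moreover the homology class of `z` at that time does not come from the homology at
a time before `b - δ`. -/
def approxRepresentatives {V : Type} (F : Filt V) (p : ℕ) (δ b : ℝ) (d : WithTop ℝ) :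
    Set (SChain V) :=
  {z | ∃ (b' : ℝ) (d' : WithTop ℝ),
    (b - δ ≤ b' ∧ b' ≤ b + δ) ∧
    (d ≤ d' + (δ : WithTop ℝ) ∧ d' ≤ d + (δ : WithTop ℝ)) ∧
    (b' : WithTop ℝ) < d' ∧
    (∀ s : ℝ, z ∈ cycles (F s) p ↔ b' ≤ s) ∧
    (∀ s : ℝ, s < b - δ → homClass (F b') p z ∉ homologyImage (F s) (F b') p) ∧
    (∀ s : ℝ, b' ≤ s → (homClass (F s) p z = 0 ↔ d' ≤ (s : WithTop ℝ)))}

/-! ### Čech filtrations and the radius -/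

/-- The Čech complex of a finite point set at scale `r` (empty for `r < 0`). -/
def cechComplex {n : ℕ} (P : Finset (EuclideanSpace ℝ (Fin n))) (r : ℝ) :
    PreAbstractSimplicialComplex P where
  faces := {σ | σ.Nonempty ∧
    (⋂ x ∈ σ, Metric.closedBall (x : EuclideanSpace ℝ (Fin n)) r).Nonempty}
  isRelLowerSet_faces := by
    rintro σ ⟨hσ, y, hy⟩
    refine ⟨hσ, fun τ hτ hne => ⟨hne, y, ?_⟩⟩
    simp only [Set.mem_iInter] at hy ⊢
    exact fun x hx => hy x (hτ hx)

/-- The Čech filtration of a finite point set. -/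
def cech {n : ℕ} (P : Finset (EuclideanSpace ℝ (Fin n))) : Filt P where
  toFun := cechComplex P
  monotone' := by
    rintro r s hrs σ ⟨hσ, y, hy⟩
    refine ⟨hσ, y, ?_⟩
    simp only [Set.mem_iInter] at hy ⊢
    exact fun x hx => Metric.closedBall_subset_closedBall hrs (hy x hx)

/-- The radius of a chain: the smallest radius of a Euclidean sphere that encloses all vertices of
all its simplices. -/
def chainRadius {n : ℕ} {P : Finset (EuclideanSpace ℝ (Fin n))} (z : SChain P) : ENNReal :=
  sInf {r : ENNReal | ∃ (c : EuclideanSpace ℝ (Fin n)) (δ : NNReal), r = δ ∧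
    ∀ σ ∈ z.support, ∀ x ∈ σ, (x : EuclideanSpace ℝ (Fin n)) ∈ Metric.closedBall c δ}

/-- The radius `r([b,d))` of an interval: the smallest radius of a representative cycle. -/
def barRadius {n : ℕ} (P : Finset (EuclideanSpace ℝ (Fin n))) (p : ℕ) (b : ℝ)
    (d : WithTop ℝ) : ENNReal :=
  ⨅ z ∈ representatives (cech P) p b d, chainRadius z

/-- The approximate radius `r^δ([b,d))` of an interval: the smallest radius of a `δ`-approximate
representative. -/
def approxBarRadius {n : ℕ} (P : Finset (EuclideanSpace ℝ (Fin n))) (p : ℕ) (δ b : ℝ)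
    (d : WithTop ℝ) : ENNReal :=
  ⨅ z ∈ approxRepresentatives (cech P) p δ b d, chainRadius z

/-! ### Persistence modules, interleavings and matchings -/

/-- A persistence module indexed by the real numbers, over the field with two elements. -/
structure PersistenceModule where
  obj : ℝ → Type
  addCommGroup : ∀ a, AddCommGroup (obj a)
  module : ∀ a, Module (ZMod 2) (obj a)
  map : ∀ {a a' : ℝ}, a ≤ a' → (obj a →ₗ[ZMod 2] obj a')
  map_refl : ∀ (a : ℝ) (x : obj a), map (le_refl a) x = x
  map_trans : ∀ {a a' a'' : ℝ} (h : a ≤ a') (h' : a' ≤ a'') (x : obj a),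
    map h' (map h x) = map (h.trans h') x

attribute [instance] PersistenceModule.addCommGroup PersistenceModule.module

/-- `M` and `N` are `ε`-interleaved. -/
def Interleaved (M N : PersistenceModule) (ε : ℝ) : Prop :=
  ∃ (hε : 0 ≤ ε) (F : ∀ a, M.obj a →ₗ[ZMod 2] N.obj (a + ε))
    (G : ∀ a, N.obj a →ₗ[ZMod 2] M.obj (a + ε)),
    (∀ (a a' : ℝ) (h : a ≤ a') (x : M.obj a),
      N.map (add_le_add_left h ε) (F a x) = F a' (M.map h x)) ∧
    (∀ (a a' : ℝ) (h : a ≤ a') (x : N.obj a),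
      M.map (add_le_add_left h ε) (G a x) = G a' (N.map h x)) ∧
    (∀ (a : ℝ) (x : M.obj a), G (a + ε) (F a x) = M.map (by linarith) x) ∧
    (∀ (a : ℝ) (x : N.obj a), F (a + ε) (G a x) = N.map (by linarith) x)

/-- The space at time `a` of the interval module of `[b,d)`: the field if `a ∈ [b,d)`, and zero
otherwise. -/
def intervalSpace (b : ℝ) (d : WithTop ℝ) (a : ℝ) : Submodule (ZMod 2) (ZMod 2) where
  carrier := {x | ¬ (b ≤ a ∧ (a : WithTop ℝ) < d) → x = 0}
  zero_mem' := fun _ => rfl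
  add_mem' := fun {x y} hx hy h => by rw [hx h, hy h, add_zero]
  smul_mem' := fun c x hx h => by rw [hx h, smul_zero]

open scoped Classical in
/-- The interval module of `[b,d)`, with identity maps inside the interval. -/
def intervalModule (b : ℝ) (d : WithTop ℝ) : PersistenceModule where
  obj a := intervalSpace b d a
  addCommGroup a := inferInstance
  module a := inferInstance
  map {a a'} _ :=
    { toFun := fun x => ⟨if b ≤ a' ∧ (a' : WithTop ℝ) < d then (x : ZMod 2) else 0,
        fun h => if_neg h⟩
      map_add' := fun x y => by
        apply Subtype.ext
        by_cases h : b ≤ a' ∧ (a' : WithTop ℝ) < d <;> simp [h]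
      map_smul' := fun c x => by
        apply Subtype.ext
        by_cases h : b ≤ a' ∧ (a' : WithTop ℝ) < d <;> simp [h] }
  map_refl a x := by
    apply Subtype.ext
    by_cases h : b ≤ a ∧ (a : WithTop ℝ) < d
    · simp [h]
    · simpa [h] using (x.2 h).symm
  map_trans {a a' a''} h h' x := by
    apply Subtype.ext
    by_cases h2 : b ≤ a'' ∧ (a'' : WithTop ℝ) < d
    · by_cases h0 : b ≤ a ∧ (a : WithTop ℝ) < d
      · have h1 : b ≤ a' ∧ (a' : WithTop ℝ) < d :=
          ⟨h0.1.trans h, lt_of_le_of_lt (WithTop.coe_le_coe.2 h') h2.2⟩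
        simp [h1, h2]
      · have hx : (x : ZMod 2) = 0 := x.2 h0
        simp [hx]
    · simp [h2]

/-- `M` is an `ε`-matching between the barcodes given by two persistent bases: every bar occurs in
at most one pair, the endpoints of matched bars differ by at most `ε` (two infinite endpoints
differ by zero), and unmatched bars have length at most `2ε`. -/
structure IsEpsMatching {V W : Type} {F : Filt V} {G : Filt W} {p : ℕ}
    (B : PersistentBasis F p) (C : PersistentBasis G p) (ε : ℝ) (M : B.ι → C.ι → Prop) :
    Prop where
  right_unique : ∀ i j j', M i j → M i j' → j = j'
  left_unique : ∀ i i' j, M i j → M i' j → i = i'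
  birth_close : ∀ i j, M i j → |B.birth i - C.birth j| ≤ ε
  death_close : ∀ i j, M i j →
    B.death i ≤ C.death j + (ε : WithTop ℝ) ∧ C.death j ≤ B.death i + (ε : WithTop ℝ)
  unmatched_left : ∀ i, (¬ ∃ j, M i j) → ¬ B.LongerThan (2 * ε) i
  unmatched_right : ∀ j, (¬ ∃ i, M i j) → ¬ C.LongerThan (2 * ε) j

/-- The bijection `f` realizes `Q` as an `ε`-perturbation of `P`. -/
def IsPerturbation {n : ℕ} {P Q : Finset (EuclideanSpace ℝ (Fin n))} (ε : ℝ) (f : P ≃ Q) :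
    Prop :=
  ∀ x : P, ‖(x : EuclideanSpace ℝ (Fin n)) - f x‖ ≤ ε

/-- `M` is an `ε`-matching between the bars of `Čech(P)` and `Čech(Q)` that is compatible with the
bijection `f` and its inverse `g`: the interval modules of matched bars `i`, `j` are
`ε`-interleaved, and either the image under `f` of the class of the `i`-th basis cycle, taken at
the birth of `i` and shifted by `ε`, involves the `j`-th basis cycle, or the other way round with
`g` in place of `f`. -/
structure IsInducedMatching {n : ℕ} {P Q : Finset (EuclideanSpace ℝ (Fin n))} {p : ℕ}
    (f : P ≃ Q) (ε : ℝ) (B : PersistentBasis (cech P) p) (C : PersistentBasis (cech Q) p)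
    (M : B.ι → C.ι → Prop) : Prop where
  isEpsMatching : IsEpsMatching B C ε M
  interleaved : ∀ i j, M i j →
    Interleaved (intervalModule (B.birth i) (B.death i)) (intervalModule (C.birth j) (C.death j)) ε
  coeff_nonzero : ∀ i j, M i j →
    C.CoeffNonzero (B.birth i + ε) (pushChain f.toEmbedding (B.cycle i)) j ∨
    B.CoeffNonzero (C.birth j + ε) (pushChain f.symm.toEmbedding (C.cycle j)) i

end

/-!
Existence of persistent bases. In the space of chains, which is finite-dimensional, the cycle
spaces of the complexes of a filtration form a chain of subspaces, and so do the boundary spaces.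
Two chains of subspaces have a common adapted basis (`exists_basis_adapted_to_two_chains`); its
members that are at some time a cycle but not a boundary form a persistent basis. Their lifetimes
are half-open intervals `[b, d)` because a simplex enters the Čech filtration at a definite time,
the minimum of a continuous proper function (`hasEntranceTimes_cech`).

The matching. A vertex bijection that moves points by at most `ε` maps the Čech complex at `s` into
the other one at `s + ε`. Expanding the images of the basis cycles gives a coefficient matrix for
`f` and one for its inverse `g`, and since `g ∘ f` is the identity on chains, their product is the
identity in all entries whose bar is alive at the relevant time (`sum_coeff_mul_coeff`). Call two
bars candidates for each other if their endpoints are `ε`-close and one of the two coefficients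
between them is nonzero. If both coefficients along a path from a bar to a second one and on to a
third are nonzero, and the first bar does not exceed the third in the order by centres, then the
middle one is close to one of the others (`epsClose_or_epsClose`), hence a candidate. So for a set
of bars longer than `2 * ε` the product stays unitriangular when only the columns of candidates are
kept, and a rank count gives Hall's condition (`exists_injective_matchCandidate`). This applies to
both sides, and an argument of Schröder–Bernstein type merges the two injections into a matching
that covers all long bars (`exists_matching_of_partial_injections`).

The radius. If `z` represents a bar longer than `2 * ε` that is `ε`-close to `[b, d)`, then its
image in the other filtration is a `2 * ε`-approximate representative of `[b, d)`: mapping back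
recovers `z`, so birth, death and the failure to come from an earlier time transfer with a shift
of `ε` (`pushChain_mem_approxRepresentatives`). The image has radius at most that of `z` plus `ε`.
-/

noncomputable section

/-! ### Bases adapted to two chains of subspaces -/

/-- Two chains of subspaces of a finite-dimensional space have a common adapted basis. The basis
is grown one vector at a time: the next vector is taken from `Z ⊓ U` outside of the current span
`W`, with `Z` the least member of the first chain that is not contained in `W`, and then `U` the
least member of the second chain such that `Z ⊓ U` is not contained in `W`. -/
theorem exists_basis_adapted_to_two_chains {K E : Type*} [Field K] [AddCommGroup E] [Module K E]
    [FiniteDimensional K E] (𝒵 𝒰 : Set (Submodule K E))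
    (h𝒵 : IsChain (· ≤ ·) 𝒵) (h𝒰 : IsChain (· ≤ ·) 𝒰) :
    ∃ T : Set E, T.Finite ∧ LinearIndepOn K id T ∧
      (∀ Z ∈ 𝒵, Z ≤ Submodule.span K (T ∩ Z)) ∧ (∀ U ∈ 𝒰, U ≤ Submodule.span K (T ∩ U)) := by
  classical
  wlog hZtop : ⊤ ∈ 𝒵 generalizing 𝒵
  · obtain ⟨T, h0, h1, h2, h3⟩ := this (insert ⊤ 𝒵)
      (h𝒵.insert fun _ _ _ => Or.inr le_top) (Set.mem_insert _ _)
    exact ⟨T, h0, h1, fun Z hZ => h2 Z (Set.mem_insert_of_mem _ hZ), h3⟩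
  wlog hUtop : ⊤ ∈ 𝒰 generalizing 𝒰
  · obtain ⟨T, h0, h1, h2, h3⟩ := this (insert ⊤ 𝒰)
      (h𝒰.insert fun _ _ _ => Or.inr le_top) (Set.mem_insert _ _)
    exact ⟨T, h0, h1, h2, fun U hU => h3 U (Set.mem_insert_of_mem _ hU)⟩
  have key : ∀ k : ℕ, k ≤ Module.finrank K E → ∃ T : Finset E, T.card = k ∧
      LinearIndepOn K id (T : Set E) ∧
      (∀ Z ∈ 𝒵, Z ⊓ Submodule.span K (T : Set E) ≤ Submodule.span K (T ∩ Z)) ∧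
      (∀ Z ∈ 𝒵, Z ≤ Submodule.span K (T : Set E) ∨ (T : Set E) ⊆ Z) ∧
      (∀ U ∈ 𝒰, U ⊓ Submodule.span K (T : Set E) ≤ Submodule.span K (T ∩ U)) := by
    intro k
    induction k with
    | zero => exact fun _ => ⟨∅, by simp [linearIndepOn_empty]⟩
    | succ k ih =>
      intro hk
      obtain ⟨T, hcard, hli, h1, h2, h3⟩ := ih (by omega)
      set W := Submodule.span K (T : Set E) with hW
      have hWtop : ¬ (⊤ : Submodule K E) ≤ W := by
        intro h
        have h4 : Module.finrank K W ≤ T.card := finrank_span_finset_le_card T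
        rw [top_le_iff.1 h, finrank_top] at h4
        omega
      -- the least member of the first chain not contained in `W`
      obtain ⟨Z, ⟨hZ, hZW⟩, hZmin⟩ := WellFounded.has_min
        (wellFounded_lt (α := Submodule K E)) {Z | Z ∈ 𝒵 ∧ ¬ Z ≤ W} ⟨⊤, hZtop, hWtop⟩
      have hZle : ∀ Z' ∈ 𝒵, Z' ≤ W ∨ Z ≤ Z' := by
        intro Z' hZ'
        by_contra! hcon
        rcases h𝒵.total hZ hZ' with h | h
        · exact hcon.2 h
        · exact hZmin Z' ⟨hZ', hcon.1⟩ (lt_of_le_not_ge h hcon.2)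
      have hTZ : (T : Set E) ⊆ Z := (h2 Z hZ).resolve_left hZW
      obtain ⟨U, ⟨hU, hUW⟩, hUmin⟩ := WellFounded.has_min
        (wellFounded_lt (α := Submodule K E)) {U | U ∈ 𝒰 ∧ ¬ Z ⊓ U ≤ W}
        ⟨⊤, hUtop, by simpa using hZW⟩
      have hUle : ∀ U' ∈ 𝒰, Z ⊓ U' ≤ W ∨ U ≤ U' := by
        intro U' hU'
        by_contra! hcon
        rcases h𝒰.total hU hU' with h | h
        · exact hcon.2 h
        · exact hUmin U' ⟨hU', hcon.1⟩ (lt_of_le_not_ge h hcon.2)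
      obtain ⟨x, ⟨hxZ, hxU⟩, hxW⟩ := SetLike.not_le_iff_exists.1 hUW
      have hxT : x ∉ T := fun h => hxW (Submodule.subset_span h)
      have hins : (T : Set E) ⊆ insert x (T : Set E) := Set.subset_insert _ _
      have hTZ' : insert x (T : Set E) ⊆ Z := Set.insert_subset hxZ hTZ
      have hWZ' : Submodule.span K (insert x (T : Set E)) ≤ Z := Submodule.span_le.2 hTZ'
      refine ⟨insert x T, by rw [Finset.card_insert_of_notMem hxT, hcard], ?_, ?_, ?_, ?_⟩
      · rw [Finset.coe_insert]
        exact hli.id_insert hxW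
      · intro Z' hZ'
        rw [Finset.coe_insert]
        rcases hZle Z' hZ' with h | h
        · intro y hy
          exact Submodule.span_mono (Set.inter_subset_inter_left _ hins) (h1 Z' hZ' ⟨hy.1, h hy.1⟩)
        · rw [Set.inter_eq_left.2 (hTZ'.trans h)]
          exact inf_le_right
      · intro Z' hZ'
        rw [Finset.coe_insert]
        exact (hZle Z' hZ').imp (fun h => h.trans (Submodule.span_mono hins))
          (fun h => hTZ'.trans h)
      · intro U' hU'
        rw [Finset.coe_insert]
        rintro y ⟨hyU, hyW⟩
        rcases hUle U' hU' with h | h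
        · exact Submodule.span_mono (Set.inter_subset_inter_left _ hins)
            (h3 U' hU' ⟨hyU, h ⟨hWZ' hyW, hyU⟩⟩)
        · obtain ⟨a, w, hw, rfl⟩ := Submodule.mem_span_insert.1 hyW
          have hwU : w ∈ U' := (U'.add_mem_iff_right (U'.smul_mem a (h hxU))).1 hyU
          exact add_mem (Submodule.smul_mem _ _
              (Submodule.subset_span ⟨Set.mem_insert _ _, h hxU⟩))
            (Submodule.span_mono (Set.inter_subset_inter_left _ hins) (h3 U' hU' ⟨hwU, hw⟩))
  obtain ⟨T, hcard, hli, h1, -, h3⟩ := key _ le_rfl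
  have htop : Submodule.span K (T : Set E) = ⊤ := by
    have := hli.linearIndependent.span_eq_top_of_card_eq_finrank' (by simpa using hcard)
    simpa using this
  rw [htop] at h1 h3
  exact ⟨T, T.finite_toSet, hli, fun Z hZ => by simpa using h1 Z hZ,
    fun U hU => by simpa using h3 U hU⟩

/-! ### Entrance times -/

/-- A set of times is an entrance set if it is empty or of the form `[d, ∞)`; the time `d`, or `⊤`
for the empty set, is the time of entrance. -/
def IsEntranceSet (S : Set ℝ) : Prop :=
  ∃ d : WithTop ℝ, ∀ s : ℝ, s ∈ S ↔ d ≤ (s : WithTop ℝ)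

theorem isEntranceSet_empty : IsEntranceSet ∅ := ⟨⊤, by simp⟩

theorem IsEntranceSet.biInter {α : Type*} {A : Finset α} (hA : A.Nonempty) {S : α → Set ℝ}
    (h : ∀ a ∈ A, IsEntranceSet (S a)) : IsEntranceSet {s | ∀ a ∈ A, s ∈ S a} := by
  classical
  choose! d hd using h
  refine ⟨A.sup' hA d, fun s => ?_⟩
  rw [Finset.sup'_le_iff]
  exact forall₂_congr fun a ha => hd a ha s

theorem IsEntranceSet.biUnion {α : Type*} {A : Set α} (hA : A.Finite) {S : α → Set ℝ}
    (h : ∀ a ∈ A, IsEntranceSet (S a)) : IsEntranceSet {s | ∃ a ∈ A, s ∈ S a} := by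
  classical
  induction A, hA using Set.Finite.induction_on with
  | empty => exact ⟨⊤, by simp⟩
  | @insert a A _ _ ih =>
    obtain ⟨d, hd⟩ := h a (Set.mem_insert _ _)
    obtain ⟨e, he⟩ := ih fun b hb => h b (Set.mem_insert_of_mem _ hb)
    refine ⟨d ⊓ e, fun s => ?_⟩
    rw [inf_le_iff, ← hd, ← he]
    simp

/-- Every simplex of the filtration has a time of entrance. -/
def HasEntranceTimes {V : Type} (F : Filt V) : Prop :=
  ∀ σ : Finset V, IsEntranceSet {s | σ ∈ F s}

section Entrance

variable {V : Type} {F : Filt V} {p : ℕ}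

theorem mem_chains_iff {K : PreAbstractSimplicialComplex V} {z : SChain V} :
    z ∈ chains K p ↔ ∀ σ ∈ z.support, σ ∈ K ∧ σ.card = p + 1 := Iff.rfl

theorem chains_mono {K L : PreAbstractSimplicialComplex V} (h : K ≤ L) (p : ℕ) :
    chains K p ≤ chains L p :=
  fun _ hz _ hσ => ⟨h (hz hσ).1, (hz hσ).2⟩

theorem cycles_mono {K L : PreAbstractSimplicialComplex V} (h : K ≤ L) (p : ℕ) :
    cycles K p ≤ cycles L p :=
  inf_le_inf_right _ (chains_mono h p)

theorem boundaries_mono {K L : PreAbstractSimplicialComplex V} (h : K ≤ L) (p : ℕ) :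
    boundaries K p ≤ boundaries L p :=
  Submodule.map_mono (chains_mono h (p + 1))

theorem homClass_eq_zero_iff {K : PreAbstractSimplicialComplex V} {z : SChain V} :
    homClass K p z = 0 ↔ z ∈ boundaries K p :=
  Submodule.Quotient.mk_eq_zero _

theorem homClass_eq_iff {K : PreAbstractSimplicialComplex V} {z w : SChain V} :
    homClass K p z = homClass K p w ↔ z - w ∈ boundaries K p := by
  rw [← sub_eq_zero, ← map_sub, homClass_eq_zero_iff]

theorem isEntranceSet_chains (hF : HasEntranceTimes F) (p : ℕ) {z : SChain V} (hz : z ≠ 0) :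
    IsEntranceSet {s | z ∈ chains (F s) p} := by
  refine IsEntranceSet.biInter (Finsupp.support_nonempty_iff.2 hz)
    (S := fun σ => {s | σ ∈ F s ∧ σ.card = p + 1}) fun σ _ => ?_
  by_cases h : σ.card = p + 1
  · simpa [h] using hF σ
  · simpa [h] using isEntranceSet_empty

theorem isEntranceSet_cycles (hF : HasEntranceTimes F) (p : ℕ) {z : SChain V} (hz : z ≠ 0) :
    IsEntranceSet {s | z ∈ cycles (F s) p} := by
  by_cases h : bdry V z = 0
  · simpa [cycles, h] using isEntranceSet_chains hF p hz
  · simpa [cycles, h] using isEntranceSet_empty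

theorem isEntranceSet_boundaries [Finite V] (hF : HasEntranceTimes F) (p : ℕ) {z : SChain V}
    (hz : z ≠ 0) : IsEntranceSet {s | z ∈ boundaries (F s) p} := by
  have : Finite (SChain V) := Finite.of_equiv _ Finsupp.equivFunOnFinite.symm
  have h := IsEntranceSet.biUnion (Set.toFinite {c : SChain V | bdry V c = z})
    (S := fun c => {s | c ∈ chains (F s) (p + 1)}) fun c hc =>
      isEntranceSet_chains hF (p + 1) fun h0 => hz (by rw [← hc, h0, map_zero])
  refine (congrArg IsEntranceSet (Set.ext fun s => ?_)).mp h
  simp only [Set.mem_ofPred_eq, boundaries, Submodule.mem_map]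
  exact exists_congr fun c => and_comm

end Entrance

/-! ### Existence of persistent bases -/

/-- A filtration of finitely many simplices, each with a time of entrance, has a persistent basis:
take a basis of the chain space adapted to the cycle spaces and the boundary spaces of all
times, and keep those of its members that are at some time a cycle but not a boundary. -/
theorem nonempty_persistentBasis {V : Type} [Finite V] {F : Filt V} (hF : HasEntranceTimes F)
    (p : ℕ) : Nonempty (PersistentBasis F p) := by
  classical
  have := Fintype.ofFinite V
  have hchain : ∀ Z : ℝ → Submodule (ZMod 2) (SChain V), Monotone Z →
      IsChain (· ≤ ·) (Set.range Z) := fun Z hZ => hZ.isChain_range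
  obtain ⟨T, hTfin, hT, hZ, hU⟩ := exists_basis_adapted_to_two_chains
    (Set.range fun s => cycles (F s) p) (Set.range fun s => boundaries (F s) p)
    (hchain _ fun s t h => cycles_mono (F.monotone h) p)
    (hchain _ fun s t h => boundaries_mono (F.monotone h) p)
  rw [Set.forall_mem_range] at hZ hU
  let ι : Type := {e : SChain V // e ∈ T ∧ ∃ s, e ∈ cycles (F s) p ∧ e ∉ boundaries (F s) p}
  have hne : ∀ e : ι, e.1 ≠ 0 := by
    rintro ⟨e, -, s, -, he⟩ rfl
    exact he (zero_mem _)
  have hbirth : ∀ e : ι, ∃ b : ℝ, ∀ s, e.1 ∈ cycles (F s) p ↔ b ≤ s := by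
    intro e
    obtain ⟨d, hd⟩ := isEntranceSet_cycles hF p (hne e)
    obtain ⟨s, hs, -⟩ := e.2.2
    have hds : d ≤ (s : WithTop ℝ) := (hd s).1 hs
    lift d to ℝ using ne_top_of_le_ne_top WithTop.coe_ne_top hds
    exact ⟨d, fun s => by simpa using hd s⟩
  choose birth hbirth using hbirth
  choose death hdeath using fun e : ι => isEntranceSet_boundaries hF p (hne e)
  simp only [Set.mem_ofPred_eq] at hdeath
  have halive : ∀ (e : ι) (s : ℝ), (birth e ≤ s ∧ (s : WithTop ℝ) < death e) ↔
      e.1 ∈ cycles (F s) p ∧ e.1 ∉ boundaries (F s) p := by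
    intro e s
    rw [hbirth, hdeath, not_le]
  have : Finite ι := Set.Finite.subset hTfin (fun e he => he.1)
  refine ⟨⟨ι, Fintype.ofFinite ι, birth, death, fun e => e.1, ?_, ?_, ?_, ?_, ?_⟩⟩
  · intro e
    obtain ⟨s, hs⟩ := e.2.2
    have := (halive e s).2 hs
    exact (WithTop.coe_le_coe.2 this.1).trans_lt this.2
  · exact fun e => (hbirth e _).2 le_rfl
  · exact fun e s hs => homClass_eq_zero_iff.2 ((hdeath e s).2 hs)
  · intro s
    have hli : LinearIndependent (ZMod 2) (fun e : T => (e : SChain V)) := hT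
    let φ : {e : ι // birth e ≤ s ∧ (s : WithTop ℝ) < death e} → T := fun e => ⟨e.1.1, e.1.2.1⟩
    have hφ : Function.Injective φ := fun e e' h =>
      Subtype.ext (Subtype.ext (congrArg (fun t : T => (t : SChain V)) h))
    refine (hli.comp φ hφ).map ?_
    rw [homClass, Submodule.ker_mkQ]
    refine Disjoint.mono_right (hU s) ?_
    have hd : Disjoint (Set.range φ) {t : T | (t : SChain V) ∈ boundaries (F s) p} := by
      rw [Set.disjoint_left]
      rintro _ ⟨e, rfl⟩ h
      exact ((halive e.1 s).1 e.2).2 h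
    have h := hli.disjoint_span_image hd
    refine h.mono ?_ ?_
    · refine Submodule.span_mono ?_
      rintro _ ⟨e, rfl⟩
      exact ⟨φ e, ⟨e, rfl⟩, rfl⟩
    · refine Submodule.span_mono ?_
      rintro x ⟨hx, hx'⟩
      exact ⟨⟨x, hx⟩, hx', rfl⟩
  · intro s
    apply le_antisymm
    · rw [Submodule.span_le]
      rintro _ ⟨e, rfl⟩
      exact ⟨e.1.1, ((halive e.1 s).1 e.2).1, rfl⟩
    · refine (Submodule.map_mono (hZ s)).trans ?_
      rw [Submodule.map_span, Submodule.span_le]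
      rintro _ ⟨x, ⟨hxT, hxZ⟩, rfl⟩
      by_cases hx : x ∈ boundaries (F s) p
      · rw [homClass_eq_zero_iff.2 hx]
        exact zero_mem _
      · let e : ι := ⟨x, hxT, s, hxZ, hx⟩
        exact Submodule.subset_span ⟨⟨e, (halive e s).2 ⟨hxZ, hx⟩⟩, rfl⟩

/-! ### Entrance times of Čech filtrations -/

theorem mem_cech_iff {n : ℕ} {P : Finset (EuclideanSpace ℝ (Fin n))} {r : ℝ} {σ : Finset P} :
    σ ∈ cech P r ↔ σ.Nonempty ∧ ∃ y : EuclideanSpace ℝ (Fin n), ∀ x ∈ σ, dist y x ≤ r := by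
  change (σ.Nonempty ∧ _) ↔ _
  simp [Set.Nonempty]

/-- A simplex enters the Čech filtration at the minimum over all points `y` of the largest distance
from `y` to its vertices. -/
theorem hasEntranceTimes_cech {n : ℕ} (P : Finset (EuclideanSpace ℝ (Fin n))) :
    HasEntranceTimes (cech P) := by
  intro σ
  by_cases hσ : σ.Nonempty
  · have hcont : Continuous fun y : EuclideanSpace ℝ (Fin n) =>
        σ.sup' hσ fun x => dist y (x : EuclideanSpace ℝ (Fin n)) :=
      Continuous.finset_sup'_apply hσ fun x _ => by fun_prop
    obtain ⟨x, hx⟩ := id hσ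
    have hle : ∀ (y : EuclideanSpace ℝ (Fin n)), ∀ x ∈ σ, dist y x ≤
        σ.sup' hσ fun x => dist y (x : EuclideanSpace ℝ (Fin n)) := fun y x hx =>
      Finset.le_sup' (fun x : P => dist y (x : EuclideanSpace ℝ (Fin n))) hx
    obtain ⟨y, hy⟩ := hcont.exists_forall_le
      (Filter.tendsto_atTop_mono (fun y => hle y x hx)
        (tendsto_dist_right_cocompact_atTop (x : EuclideanSpace ℝ (Fin n))))
    refine ⟨((σ.sup' hσ fun x => dist y (x : EuclideanSpace ℝ (Fin n)) : ℝ) : WithTop ℝ),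
      fun s => ?_⟩
    rw [Set.mem_ofPred_eq, mem_cech_iff, WithTop.coe_le_coe]
    constructor
    · rintro ⟨-, w, hw⟩
      exact (hy w).trans (Finset.sup'_le _ _ hw)
    · exact fun h => ⟨hσ, y, fun x hx => (hle y x hx).trans h⟩
  · have : {s | σ ∈ cech P s} = ∅ := Set.eq_empty_of_forall_notMem fun s hs =>
      hσ (mem_cech_iff.1 hs).1
    rw [this]
    exact isEntranceSet_empty

theorem nonempty_persistentBasis_cech {n : ℕ} (P : Finset (EuclideanSpace ℝ (Fin n))) (p : ℕ) :
    Nonempty (PersistentBasis (cech P) p) :=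
  nonempty_persistentBasis (hasEntranceTimes_cech P) p

/-! ### Chain maps induced by injective maps of vertices -/

section PushChain

variable {V W : Type} {p : ℕ}

theorem bdry_pushChain (f : V ↪ W) (z : SChain V) :
    bdry W (pushChain f z) = pushChain f (bdry V z) := by
  classical
  suffices h : bdry W ∘ₗ pushChain f = pushChain f ∘ₗ bdry V from LinearMap.congr_fun h z
  refine Finsupp.lhom_ext' fun σ => LinearMap.ext_ring ?_
  simp only [LinearMap.coe_comp, Function.comp_apply, Finsupp.lsingle_apply, pushChain,
    Finsupp.lmapDomain_apply, Finsupp.mapDomain_single, bdry, Finsupp.linearCombination_single,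
    one_smul, Finset.card_map]
  split_ifs
  · simp only [← Finsupp.lmapDomain_apply (ZMod 2) (R := ZMod 2), map_sum, Finset.sum_map]
    refine Finset.sum_congr rfl fun v _ => ?_
    rw [Finsupp.lmapDomain_apply, Finsupp.mapDomain_single, Finset.map_erase]
  · simp

theorem exists_of_mem_support_pushChain (f : V ↪ W) {z : SChain V} {τ : Finset W}
    (h : τ ∈ (pushChain f z).support) : ∃ σ ∈ z.support, σ.map f = τ := by
  classical
  simpa using Finsupp.mapDomain_support (f := fun σ : Finset V => σ.map f) h

theorem pushChain_symm_pushChain (f : V ≃ W) (z : SChain V) :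
    pushChain f.symm.toEmbedding (pushChain f.toEmbedding z) = z := by
  change Finsupp.mapDomain _ (Finsupp.mapDomain _ z) = z
  rw [← Finsupp.mapDomain_comp]
  convert Finsupp.mapDomain_id
  ext σ : 1
  ext x
  simp

/-- The vertex map `f` sends the complex at time `s` into the complex at time `s + ε`. -/
def ShiftsSimplices (f : V ↪ W) (ε : ℝ) (F : Filt V) (G : Filt W) : Prop :=
  ∀ (s : ℝ) (σ : Finset V), σ ∈ F s → σ.map f ∈ G (s + ε)

variable {f : V ↪ W} {ε : ℝ} {F : Filt V} {G : Filt W}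

namespace ShiftsSimplices

theorem pushChain_mem_chains (h : ShiftsSimplices f ε F G) {s : ℝ} {z : SChain V}
    (hz : z ∈ chains (F s) p) : pushChain f z ∈ chains (G (s + ε)) p := by
  rw [mem_chains_iff] at hz ⊢
  intro τ hτ
  obtain ⟨σ, hσ, rfl⟩ := exists_of_mem_support_pushChain f hτ
  exact ⟨h s σ (hz σ hσ).1, by rw [Finset.card_map, (hz σ hσ).2]⟩

theorem pushChain_mem_cycles (h : ShiftsSimplices f ε F G) {s : ℝ} {z : SChain V}
    (hz : z ∈ cycles (F s) p) : pushChain f z ∈ cycles (G (s + ε)) p := by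
  refine ⟨h.pushChain_mem_chains hz.1, ?_⟩
  rw [SetLike.mem_coe, LinearMap.mem_ker, bdry_pushChain, LinearMap.mem_ker.1 hz.2, map_zero]

theorem pushChain_mem_boundaries (h : ShiftsSimplices f ε F G) {s : ℝ} {z : SChain V}
    (hz : z ∈ boundaries (F s) p) : pushChain f z ∈ boundaries (G (s + ε)) p := by
  obtain ⟨c, hc, rfl⟩ := hz
  exact ⟨pushChain f c, h.pushChain_mem_chains hc, bdry_pushChain f c⟩

end ShiftsSimplices

end PushChain

/-! ### Expansions in a persistent basis -/

namespace PersistentBasis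

variable {V : Type} {F : Filt V} {p : ℕ} (B : PersistentBasis F p)

/-- The bar `i` contains the time `s`. -/
abbrev Alive (s : ℝ) (i : B.ι) : Prop :=
  B.birth i ≤ s ∧ (s : WithTop ℝ) < B.death i

/-- The class of `z` at time `s` is the combination with coefficients `c` of the basis classes that
are alive at time `s`. -/
def IsExpansion (s : ℝ) (z : SChain V) (c : B.ι → ZMod 2) : Prop :=
  (∀ k, c k ≠ 0 → B.Alive s k) ∧
    homClass (F s) p z = ∑ k, c k • homClass (F s) p (B.cycle k)

variable {B}

theorem cycle_mem_cycles {s : ℝ} {i : B.ι} (h : B.birth i ≤ s) : B.cycle i ∈ cycles (F s) p :=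
  cycles_mono (F.monotone h) p (B.cycle_mem i)

theorem exists_isExpansion {s : ℝ} {z : SChain V} (hz : z ∈ cycles (F s) p) :
    ∃ c, B.IsExpansion s z c := by
  classical
  have h : homClass (F s) p z ∈ homology (F s) p := ⟨z, hz, rfl⟩
  rw [← B.span_eq s, Submodule.mem_span_range_iff_exists_fun] at h
  obtain ⟨c, hc⟩ := h
  refine ⟨fun k => if hk : B.Alive s k then c ⟨k, hk⟩ else 0, fun k hk => ?_, ?_⟩
  · by_contra h
    exact hk (dif_neg h)
  · rw [← hc]
    refine Fintype.sum_of_injective Subtype.val Subtype.val_injective _ _ (fun k hk => ?_)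
      (fun k => ?_)
    · beta_reduce
      rw [dif_neg (fun h => hk ⟨⟨k, h⟩, rfl⟩), zero_smul]
    · beta_reduce
      rw [dif_pos k.2]

theorem IsExpansion.unique {s : ℝ} {z : SChain V} {c c' : B.ι → ZMod 2}
    (h : B.IsExpansion s z c) (h' : B.IsExpansion s z c') : c = c' := by
  classical
  have hout : ∀ k, ¬ B.Alive s k → c k - c' k = 0 := by
    intro k hk
    rw [not_not.1 (mt (h.1 k) hk), not_not.1 (mt (h'.1 k) hk), sub_zero]
  have hsum : ∑ k, (c k - c' k) • homClass (F s) p (B.cycle k) = 0 := by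
    simp only [sub_smul, Finset.sum_sub_distrib, ← h.2, ← h'.2, sub_self]
  have hli := Fintype.linearIndependent_iff.1 (B.linearIndependent s) (fun k => c k.1 - c' k.1)
    ((Fintype.sum_of_injective Subtype.val Subtype.val_injective _ _
      (fun k hk => by rw [hout k (fun h => hk ⟨⟨k, h⟩, rfl⟩), zero_smul])
      (fun k => rfl)).trans hsum)
  funext k
  by_cases hk : B.Alive s k
  · exact sub_eq_zero.1 (hli ⟨k, hk⟩)
  · exact sub_eq_zero.1 (hout k hk)

theorem IsExpansion.apply_eq_zero {s : ℝ} {z : SChain V} {c : B.ι → ZMod 2}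
    (h : B.IsExpansion s z c) {k : B.ι} (hk : ¬ B.Alive s k) : c k = 0 :=
  by_contra fun h0 => hk (h.1 k h0)

/-- The expansion at a later time is obtained by dropping the bars that have ended. -/
theorem IsExpansion.of_le {s t : ℝ} (hst : s ≤ t) {z : SChain V} {c : B.ι → ZMod 2}
    (h : B.IsExpansion s z c) {c' : B.ι → ZMod 2} (h1 : ∀ k, B.Alive t k → c' k = c k)
    (h2 : ∀ k, ¬ B.Alive t k → c' k = 0) : B.IsExpansion t z c' := by
  refine ⟨fun k hk => by_contra fun h0 => hk (h2 k h0), ?_⟩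
  have h3 := h.2
  simp only [← map_smul, ← map_sum] at h3
  rw [homClass_eq_iff] at h3
  have h4 := homClass_eq_iff.2 (boundaries_mono (F.monotone hst) p h3)
  rw [h4]
  simp only [map_smul, map_sum]
  refine Finset.sum_congr rfl fun k _ => ?_
  by_cases hk : B.Alive t k
  · rw [h1 k hk]
  · rw [h2 k hk, zero_smul]
    by_cases hc : c k = 0
    · rw [hc, zero_smul]
    · have hd : B.death k ≤ (t : WithTop ℝ) :=
        not_lt.1 fun hlt => hk ⟨(h.1 k hc).1.trans hst, hlt⟩
      rw [B.cycle_dead k t hd, smul_zero]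

open scoped Classical in
theorem isExpansion_cycle {s : ℝ} {i : B.ι} (h : B.Alive s i) :
    B.IsExpansion s (B.cycle i) (Pi.single i 1) := by
  refine ⟨fun k hk => ?_, ?_⟩
  · obtain rfl : k = i := by
      by_contra hki
      simp [hki] at hk
    exact h
  · simp [Pi.single_apply]

theorem IsExpansion.sum {α : Type*} {s : ℝ} (A : Finset α) {z : α → SChain V}
    {c : α → B.ι → ZMod 2} (h : ∀ a ∈ A, B.IsExpansion s (z a) (c a)) :
    B.IsExpansion s (∑ a ∈ A, z a) (∑ a ∈ A, c a) := by
  refine ⟨fun k hk => ?_, ?_⟩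
  · by_contra h0
    refine hk ?_
    rw [Finset.sum_apply]
    exact Finset.sum_eq_zero fun a ha => (h a ha).apply_eq_zero h0
  · rw [map_sum, Finset.sum_congr rfl fun a ha => (h a ha).2, Finset.sum_comm]
    simp [Finset.sum_smul]

theorem IsExpansion.smul {s : ℝ} {z : SChain V} {c : B.ι → ZMod 2} (h : B.IsExpansion s z c)
    (a : ZMod 2) : B.IsExpansion s (a • z) (a • c) := by
  refine ⟨fun k hk => h.1 k fun h0 => hk (by simp [h0]), ?_⟩
  rw [map_smul, h.2, Finset.smul_sum]
  simp [mul_smul]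

theorem IsExpansion.congr {s : ℝ} {z w : SChain V} {c : B.ι → ZMod 2} (h : B.IsExpansion s z c)
    (hzw : homClass (F s) p w = homClass (F s) p z) : B.IsExpansion s w c :=
  ⟨h.1, hzw.trans h.2⟩

/-- While a bar lasts, the class of its cycle does not come from a time before its birth. -/
theorem homClass_cycle_notMem_homologyImage {i : B.ι} {s t : ℝ} (hs : s < B.birth i)
    (ht : B.Alive t i) : homClass (F t) p (B.cycle i) ∉ homologyImage (F s) (F t) p := by
  classical
  rintro ⟨y, hy, hyz⟩
  obtain ⟨c, hc⟩ := B.exists_isExpansion hy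
  have h1 := hc.of_le (hs.le.trans ht.1) (c' := fun k => if B.Alive t k then c k else 0)
    (fun k hk => if_pos hk) (fun k hk => if_neg hk)
  have h2 := congrFun ((h1.congr hyz.symm).unique (isExpansion_cycle ht)) i
  rw [if_pos ht, Pi.single_eq_same, hc.apply_eq_zero fun h => hs.not_ge h.1] at h2
  exact zero_ne_one h2

theorem homClass_cycle_ne_zero {i : B.ι} {t : ℝ} (ht : B.Alive t i) :
    homClass (F t) p (B.cycle i) ≠ 0 := by
  exact (B.linearIndependent t).ne_zero ⟨i, ht⟩

/-- The cycle of a bar enters the filtration at its birth. -/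
theorem cycle_mem_cycles_iff {i : B.ι} {s : ℝ} : B.cycle i ∈ cycles (F s) p ↔ B.birth i ≤ s := by
  refine ⟨fun h => ?_, cycle_mem_cycles⟩
  by_contra! hs
  exact homClass_cycle_notMem_homologyImage hs ⟨le_rfl, B.birth_lt_death i⟩ ⟨_, h, rfl⟩

theorem homClass_cycle_eq_zero_iff {i : B.ι} {s : ℝ} (hs : B.birth i ≤ s) :
    homClass (F s) p (B.cycle i) = 0 ↔ B.death i ≤ (s : WithTop ℝ) := by
  refine ⟨fun h => ?_, B.cycle_dead i s⟩
  by_contra! hd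
  exact homClass_cycle_ne_zero ⟨hs, hd⟩ h

end PersistentBasis

/-! ### Close intervals -/

/-- The endpoints of `[b, d)` and `[b', d')` differ by at most `ε`, two infinite endpoints
differing by zero. -/
def EpsClose (ε b : ℝ) (d : WithTop ℝ) (b' : ℝ) (d' : WithTop ℝ) : Prop :=
  |b - b'| ≤ ε ∧ d ≤ d' + (ε : WithTop ℝ) ∧ d' ≤ d + (ε : WithTop ℝ)

theorem EpsClose.symm {ε b b' : ℝ} {d d' : WithTop ℝ} (h : EpsClose ε b d b' d') :
    EpsClose ε b' d' b d :=
  ⟨by rw [abs_sub_comm]; exact h.1, h.2.2, h.2.1⟩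

/-- Intervals are ordered by their centre, and those that have no end by their birth. -/
def barKey (b : ℝ) (d : WithTop ℝ) : WithTop ℝ ×ₗ ℝ := toLex (d + (b : WithTop ℝ), b)

/-- The first four hypotheses hold when there are nonzero maps, shifted by `ε`, from the interval
module of `[b, d)` to that of `[c, e)` and from the latter to that of `[b', d')`. If the first
interval does not exceed the last one in the order by centres, then the middle one is `ε`-close to
one of them. -/
theorem epsClose_or_epsClose {ε b c b' : ℝ} {d e d' : WithTop ℝ}
    (hcb : c ≤ b + ε) (hed : e ≤ d + (ε : WithTop ℝ))
    (hbc : b' ≤ c + ε) (hde : d' ≤ e + (ε : WithTop ℝ)) (hkey : barKey b d ≤ barKey b' d') :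
    EpsClose ε b d c e ∨ EpsClose ε b' d' c e := by
  rw [barKey, barKey, Prod.Lex.toLex_le_toLex] at hkey
  unfold EpsClose
  induction d with
  | top =>
    have hd' : d' = ⊤ := by
      induction d' with
      | top => rfl
      | coe d' => exact absurd hkey (by simp [← WithTop.coe_add])
    subst hd'
    have he : e = ⊤ := by
      induction e with
      | top => rfl
      | coe e => exact absurd hde (by simp [← WithTop.coe_add])
    subst he
    have hbb : b ≤ b' := by simpa using hkey
    left
    simp only [top_add, le_refl, and_true, abs_le]
    constructor <;> linarith
  | coe d =>
    induction e with
    | top => exact absurd hed (by simp [← WithTop.coe_add])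
    | coe e =>
      induction d' with
      | top => exact absurd hde (by simp [← WithTop.coe_add])
      | coe d' =>
        simp only [← WithTop.coe_add, WithTop.coe_le_coe, WithTop.coe_lt_coe,
          WithTop.coe_inj] at *
        have hsum : d + b ≤ d' + b' := by
          rcases hkey with h | h
          · exact h.le
          · exact h.1.le
        by_contra! hcon
        obtain ⟨h1, h2⟩ := hcon
        rw [abs_le] at h1 h2
        by_cases h3 : b - c ≤ ε
        · have h4 := h1 ⟨by linarith, h3⟩
          by_cases h5 : c - b' ≤ ε
          · have := h2 ⟨by linarith, by linarith⟩
            by_cases h6 : d ≤ e + ε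
            · linarith [h4 h6]
            · linarith [this hde]
          · by_cases h6 : d ≤ e + ε
            · linarith [h4 h6]
            · linarith
        · by_cases h5 : c - b' ≤ ε
          · have := h2 ⟨by linarith, by linarith⟩
            linarith [this hde]
          · linarith

/-- The number `x`, which vanishes unless `[b, d)` contains `a`, carried over to the interval
module of `[b', d')` at time `a + ε`. -/
def intervalShift (ε b : ℝ) (d : WithTop ℝ) (b' : ℝ) (d' : WithTop ℝ) (a : ℝ) :
    (intervalModule b d).obj a →ₗ[ZMod 2] (intervalModule b' d').obj (a + ε) := by
  classical
  exact
  { toFun := fun x => ⟨if b' ≤ a + ε ∧ ((a + ε : ℝ) : WithTop ℝ) < d' then x.1 else 0,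
      fun h => if_neg h⟩
    map_add' := fun x y => by
      apply Subtype.ext
      change ite _ (x.1 + y.1) 0 = ite _ x.1 0 + ite _ y.1 0
      split_ifs <;> simp
    map_smul' := fun c x => by
      apply Subtype.ext
      change ite _ (c • x.1) 0 = c • ite _ x.1 0
      split_ifs <;> simp }

theorem intervalShift_natural {ε b b' : ℝ} {d d' : WithTop ℝ} (h : EpsClose ε b d b' d')
    {a a' : ℝ} (haa : a ≤ a') (x : (intervalModule b d).obj a) :
    (intervalModule b' d').map (add_le_add_left haa ε) (intervalShift ε b d b' d' a x) =
      intervalShift ε b d b' d' a' ((intervalModule b d).map haa x) := by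
  classical
  apply Subtype.ext
  change (if b' ≤ a' + ε ∧ ((a' + ε : ℝ) : WithTop ℝ) < d' then
      (if b' ≤ a + ε ∧ ((a + ε : ℝ) : WithTop ℝ) < d' then x.1 else 0) else 0) =
    if b' ≤ a' + ε ∧ ((a' + ε : ℝ) : WithTop ℝ) < d' then
      (if b ≤ a' ∧ (a' : WithTop ℝ) < d then x.1 else 0) else 0
  by_cases hx : b ≤ a ∧ (a : WithTop ℝ) < d
  · by_cases h' : b' ≤ a' + ε ∧ ((a' + ε : ℝ) : WithTop ℝ) < d'
    · have h1 : b' ≤ a + ε ∧ ((a + ε : ℝ) : WithTop ℝ) < d' :=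
        ⟨by linarith [(abs_le.1 h.1).1, hx.1],
          lt_of_le_of_lt (WithTop.coe_le_coe.2 (by linarith)) h'.2⟩
      have h2 : b ≤ a' ∧ (a' : WithTop ℝ) < d := by
        refine ⟨hx.1.trans haa, ?_⟩
        have h3 := h'.2.trans_le h.2.2
        rw [WithTop.coe_add] at h3
        exact lt_of_add_lt_add_right h3
      rw [if_pos h', if_pos h', if_pos h1, if_pos h2]
    · rw [if_neg h', if_neg h']
  · rw [show x.1 = 0 from x.2 hx]
    simp only [ite_self]

theorem intervalShift_intervalShift {ε b b' : ℝ} {d d' : WithTop ℝ} (hε : 0 ≤ ε)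
    (h : EpsClose ε b d b' d') (a : ℝ) (x : (intervalModule b d).obj a) :
    intervalShift ε b' d' b d (a + ε) (intervalShift ε b d b' d' a x) =
      (intervalModule b d).map (by linarith) x := by
  classical
  apply Subtype.ext
  change (if b ≤ a + ε + ε ∧ ((a + ε + ε : ℝ) : WithTop ℝ) < d then
      (if b' ≤ a + ε ∧ ((a + ε : ℝ) : WithTop ℝ) < d' then x.1 else 0) else 0) =
    if b ≤ a + ε + ε ∧ ((a + ε + ε : ℝ) : WithTop ℝ) < d then x.1 else 0
  by_cases hx : b ≤ a ∧ (a : WithTop ℝ) < d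
  · by_cases h' : b ≤ a + ε + ε ∧ ((a + ε + ε : ℝ) : WithTop ℝ) < d
    · have h1 : b' ≤ a + ε ∧ ((a + ε : ℝ) : WithTop ℝ) < d' := by
        refine ⟨by linarith [(abs_le.1 h.1).1, hx.1], ?_⟩
        have h3 := h'.2.trans_le h.2.1
        rw [WithTop.coe_add] at h3
        exact lt_of_add_lt_add_right h3
      rw [if_pos h', if_pos h', if_pos h1]
    · rw [if_neg h', if_neg h']
  · rw [show x.1 = 0 from x.2 hx]
    simp only [ite_self]

theorem EpsClose.interleaved {ε b b' : ℝ} {d d' : WithTop ℝ} (hε : 0 ≤ ε)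
    (h : EpsClose ε b d b' d') :
    Interleaved (intervalModule b d) (intervalModule b' d') ε :=
  ⟨hε, intervalShift ε b d b' d', intervalShift ε b' d' b d,
    fun _ _ haa x => intervalShift_natural h haa x,
    fun _ _ haa x => intervalShift_natural h.symm haa x,
    fun a x => intervalShift_intervalShift hε h a x,
    fun a x => intervalShift_intervalShift hε h.symm a x⟩

/-! ### Matchings in bipartite relations -/

/-- If one partial injection along a relation is defined on all `x` with `p x`, and another one in
the opposite direction on all `y` with `q y`, then a single matching covers both sets: pad both
sides with infinitely many dummies, to which the remaining elements may be matched, and apply the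
Schröder–Bernstein theorem. -/
theorem exists_matching_of_partial_injections {X Y : Type*} (R : X → Y → Prop) (p : X → Prop)
    (q : Y → Prop) {φ : {x // p x} → Y} (hφ : Function.Injective φ) (hφR : ∀ x, R x.1 (φ x))
    {ψ : {y // q y} → X} (hψ : Function.Injective ψ) (hψR : ∀ y, R (ψ y) y.1) :
    ∃ M : X → Y → Prop, (∀ x y, M x y → R x y) ∧ (∀ x y y', M x y → M x y' → y = y') ∧
      (∀ x x' y, M x y → M x' y → x = x') ∧ (∀ x, p x → ∃ y, M x y) ∧
      ∀ y, q y → ∃ x, M x y := by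
  classical
  let Φ : X ⊕ (X ⊕ Y) × ℕ → Y ⊕ (X ⊕ Y) × ℕ := Sum.elim
    (fun x => if h : p x then Sum.inl (φ ⟨x, h⟩) else Sum.inr (Sum.inl x, 0))
    (fun d => Sum.inr (d.1, d.2 + 1))
  let Ψ : Y ⊕ (X ⊕ Y) × ℕ → X ⊕ (X ⊕ Y) × ℕ := Sum.elim
    (fun y => if h : q y then Sum.inl (ψ ⟨y, h⟩) else Sum.inr (Sum.inr y, 0))
    (fun d => Sum.inr (d.1, d.2 + 1))
  let S : X ⊕ (X ⊕ Y) × ℕ → Y ⊕ (X ⊕ Y) × ℕ → Prop := fun a b =>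
    Sum.elim (fun x => Sum.elim (fun y => R x y) (fun _ => ¬ p x) b)
      (fun _ => Sum.elim (fun y => ¬ q y) (fun _ => True) b) a
  have hΦ : Function.Injective Φ := by
    rintro (x | ⟨d, k⟩) (x' | ⟨d', k'⟩) h
    · by_cases hx : p x <;> by_cases hx' : p x' <;> simp [Φ, hx, hx'] at h
      · simpa using hφ h
      · rw [h]
    · by_cases hx : p x <;> simp [Φ, hx] at h
    · by_cases hx : p x' <;> simp [Φ, hx] at h
    · simpa [Φ] using h
  have hΨ : Function.Injective Ψ := by
    rintro (y | ⟨d, k⟩) (y' | ⟨d', k'⟩) h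
    · by_cases hy : q y <;> by_cases hy' : q y' <;> simp [Ψ, hy, hy'] at h
      · simpa using hψ h
      · rw [h]
    · by_cases hy : q y <;> simp [Ψ, hy] at h
    · by_cases hy : q y' <;> simp [Ψ, hy] at h
    · simpa [Ψ] using h
  obtain ⟨h, hbij, hS⟩ := Function.Embedding.schroeder_bernstein_of_rel hΦ hΨ S
    (by
      rintro (x | d)
      · by_cases hx : p x
        · simpa [S, Φ, hx] using hφR ⟨x, hx⟩
        · simp [S, Φ, hx]
      · simp [S, Φ])
    (by
      rintro (y | d)
      · by_cases hy : q y
        · simpa [S, Ψ, hy] using hψR ⟨y, hy⟩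
        · simp [S, Ψ, hy]
      · simp [S, Ψ])
  refine ⟨fun x y => h (Sum.inl x) = Sum.inl y, fun x y hxy => ?_, fun x y y' h1 h2 => ?_,
    fun x x' y h1 h2 => ?_, fun x hx => ?_, fun y hy => ?_⟩
  · have := hS (Sum.inl x)
    rw [hxy] at this
    exact this
  · exact Sum.inl_injective (h1.symm.trans h2)
  · exact Sum.inl_injective (hbij.1 (h1.trans h2.symm))
  · have := hS (Sum.inl x)
    rcases hy : h (Sum.inl x) with y | d
    · exact ⟨y, hy⟩
    · rw [hy] at this
      exact absurd hx this
  · obtain ⟨x | d, hx⟩ := hbij.2 (Sum.inl y)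
    · exact ⟨x, hx⟩
    · have := hS (Sum.inr d)
      rw [hx] at this
      exact absurd hy this

/-! ### The coefficients of shifted basis cycles -/

namespace PersistentBasis

variable {V W : Type} {F : Filt V} {G : Filt W} {p : ℕ} {f : V ≃ W} {ε : ℝ}
  {B : PersistentBasis F p} {C : PersistentBasis G p}

theorem CoeffNonzero.of_isExpansion {s : ℝ} {z : SChain V} {c : B.ι → ZMod 2}
    (h : B.IsExpansion s z c) {i : B.ι} (hi : c i ≠ 0) : B.CoeffNonzero s z i :=
  ⟨c, h.1, h.2, hi⟩

/-- A bar that occurs in the image of the `i`-th basis cycle ends no later than the `i`-th bar,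
up to the shift. -/
theorem IsExpansion.death_le_of_ne_zero {f : V ↪ W} (hf : ShiftsSimplices f ε F G) {i : B.ι}
    {c : C.ι → ZMod 2} (h : C.IsExpansion (B.birth i + ε) (pushChain f (B.cycle i)) c) {j : C.ι}
    (hj : c j ≠ 0) : C.death j ≤ B.death i + (ε : WithTop ℝ) := by
  classical
  have hlt := B.birth_lt_death i
  have hzero := B.cycle_dead i
  induction hd : B.death i with
  | top => simp
  | coe d =>
    rw [hd] at hlt hzero
    by_contra! hcon
    rw [← WithTop.coe_add] at hcon
    have hbd : B.birth i + ε ≤ d + ε := by linarith [WithTop.coe_lt_coe.1 hlt]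
    have halive : C.Alive (d + ε) j := ⟨(h.1 j hj).1.trans hbd, hcon⟩
    have h1 := h.of_le hbd (c' := fun k => if C.Alive (d + ε) k then c k else 0)
      (fun k hk => if_pos hk) (fun k hk => if_neg hk)
    have h2 : C.IsExpansion (d + ε) (pushChain f (B.cycle i)) 0 :=
      ⟨fun k hk => absurd rfl hk, by
        rw [homClass_eq_zero_iff.2
          (hf.pushChain_mem_boundaries (homClass_eq_zero_iff.1 (hzero d le_rfl)))]
        simp⟩
    have h3 := congrFun (h1.unique h2) j
    rw [if_pos halive] at h3
    exact hj h3

/-- The product of the coefficient matrices of `f` and of its inverse has the entries of the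
identity matrix in the columns of bars that are alive after both shifts. -/
theorem sum_coeff_mul_coeff
    (hg : ShiftsSimplices f.symm.toEmbedding ε G F) (hε : 0 ≤ ε) [DecidableEq B.ι] {i : B.ι}
    {φ : C.ι → ZMod 2} {γ : C.ι → B.ι → ZMod 2}
    (hφ : C.IsExpansion (B.birth i + ε) (pushChain f.toEmbedding (B.cycle i)) φ)
    (hγ : ∀ j, B.IsExpansion (C.birth j + ε) (pushChain f.symm.toEmbedding (C.cycle j)) (γ j))
    {k : B.ι} (hk : B.Alive (B.birth i + ε + ε) k) :
    ∑ j, φ j * γ j k = if k = i then 1 else 0 := by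
  classical
  set t := B.birth i + ε + ε with ht
  have h1 : B.IsExpansion t (B.cycle i)
      (fun k => if B.Alive t k then (Pi.single i 1 : B.ι → ZMod 2) k else 0) := by
    refine (isExpansion_cycle ⟨le_rfl, B.birth_lt_death i⟩).of_le (by linarith) (fun k hk => ?_)
      (fun k hk => if_neg hk)
    rw [if_pos hk]
    congr!
  have h2 : B.IsExpansion t (∑ j, φ j • pushChain f.symm.toEmbedding (C.cycle j))
      (∑ j, fun k => if B.Alive t k then φ j * γ j k else 0) := by
    refine IsExpansion.sum _ fun j _ => ?_
    by_cases hj : φ j = 0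
    · simp only [hj, zero_smul, zero_mul, ite_self]
      exact ⟨fun k hk => absurd rfl hk, by simp⟩
    · exact ((hγ j).smul (φ j)).of_le (by linarith [(hφ.1 j hj).1]) (fun k hk => if_pos hk)
        (fun k hk => if_neg hk)
  have h3 : homClass (F t) p (B.cycle i) =
      homClass (F t) p (∑ j, φ j • pushChain f.symm.toEmbedding (C.cycle j)) := by
    have h4 := hφ.2
    simp only [← map_smul, ← map_sum] at h4
    have h5 := hg.pushChain_mem_boundaries (homClass_eq_iff.1 h4)
    rw [map_sub, pushChain_symm_pushChain] at h5
    simpa only [map_sum, map_smul] using homClass_eq_iff.2 h5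
  have h6 := congrFun (h1.unique (h2.congr h3)) k
  rw [Finset.sum_apply] at h6
  simp only [if_pos hk] at h6
  rw [← h6, Pi.single_apply]

variable (f ε B C) in
/-- The pairs of bars that may be matched: those with close endpoints such that one of the two
cycles occurs in the expansion of the image of the other one. -/
def MatchCandidate (i : B.ι) (j : C.ι) : Prop :=
  EpsClose ε (B.birth i) (B.death i) (C.birth j) (C.death j) ∧
    (C.CoeffNonzero (B.birth i + ε) (pushChain f.toEmbedding (B.cycle i)) j ∨
      B.CoeffNonzero (C.birth j + ε) (pushChain f.symm.toEmbedding (C.cycle j)) i)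

/-- The bars of length greater than `2 * ε` satisfy Hall's condition. For a set `A` of them,
restrict the coefficient matrix of `f` to the rows in `A` and to the columns that are candidates
for a member of `A`, and multiply it by the coefficient matrix of the inverse of `f`. Dropping the
other columns does not change the entries of the product from a bar to a bar that is not smaller
in the order by centres, so the product is unitriangular. Hence the restricted rows are
independent, and there are at least as many columns as rows. -/
theorem exists_injective_matchCandidate (hf : ShiftsSimplices f.toEmbedding ε F G)
    (hg : ShiftsSimplices f.symm.toEmbedding ε G F) (hε : 0 ≤ ε)
    (B : PersistentBasis F p) (C : PersistentBasis G p) :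
    ∃ m : {i // B.LongerThan (2 * ε) i} → C.ι, Function.Injective m ∧
      ∀ i, MatchCandidate f ε B C i.1 (m i) := by
  classical
  choose φ hφ using fun i : B.ι => C.exists_isExpansion (hf.pushChain_mem_cycles (B.cycle_mem i))
  choose γ hγ using fun j : C.ι => B.exists_isExpansion (hg.pushChain_mem_cycles (C.cycle_mem j))
  let N : {i // B.LongerThan (2 * ε) i} → Finset C.ι := fun i =>
    {j | MatchCandidate f ε B C i.1 j}
  obtain ⟨m, hm, hmN⟩ := (Finset.all_card_le_biUnion_card_iff_exists_injective N).1 (by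
    intro A
    let key : {i // B.LongerThan (2 * ε) i} → WithTop ℝ ×ₗ ℝ := fun i =>
      barKey (B.birth i.1) (B.death i.1)
    have hentry : ∀ i ∈ A, ∀ i' ∈ A, key i ≤ key i' →
        ∑ j ∈ A.biUnion N, φ i.1 j * γ j i'.1 = if i' = i then 1 else 0 := by
      intro i hi i' hi' hkey
      have hterm : ∀ j, φ i.1 j * γ j i'.1 ≠ 0 → j ∈ A.biUnion N ∧
          B.Alive (B.birth i.1 + ε + ε) i'.1 := by
        intro j hj
        have h1 : φ i.1 j ≠ 0 := left_ne_zero_of_mul hj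
        have h2 : γ j i'.1 ≠ 0 := right_ne_zero_of_mul hj
        have a1 := ((hφ i.1).1 j h1).1
        have a2 := ((hγ j).1 i'.1 h2).1
        constructor
        · rw [Finset.mem_biUnion]
          rcases epsClose_or_epsClose a1 ((hφ i.1).death_le_of_ne_zero hf h1) a2
            ((hγ j).death_le_of_ne_zero hg h2) hkey with h | h
          · exact ⟨i, hi, Finset.mem_filter.2 ⟨Finset.mem_univ _, h,
              Or.inl (.of_isExpansion (hφ i.1) h1)⟩⟩
          · exact ⟨i', hi', Finset.mem_filter.2 ⟨Finset.mem_univ _, h,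
              Or.inr (.of_isExpansion (hγ j) h2)⟩⟩
        · refine ⟨by linarith, ?_⟩
          -- a long bar that has ended by then lies before the bar `i` at both ends
          by_contra! hd
          have l1 := i.2
          have l2 := i'.2
          unfold LongerThan at l1 l2
          rw [show key i = barKey _ _ from rfl, show key i' = barKey _ _ from rfl, barKey, barKey,
            Prod.Lex.toLex_le_toLex] at hkey
          generalize B.death i'.1 = d' at *
          generalize B.death i.1 = d at *
          lift d' to ℝ using ne_top_of_le_ne_top WithTop.coe_ne_top hd
          induction d with
          | top => exact absurd hkey (by simp [← WithTop.coe_add])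
          | coe d =>
            simp only [← WithTop.coe_add, WithTop.coe_le_coe, WithTop.coe_lt_coe,
              WithTop.coe_inj] at *
            rcases hkey with h | h
            · linarith
            · linarith [h.1]
      by_cases halive : B.Alive (B.birth i.1 + ε + ε) i'.1
      · rw [Finset.sum_subset (Finset.subset_univ _) fun j _ hj =>
          by_contra fun h => hj (hterm j h).1, sum_coeff_mul_coeff hg hε (hφ i.1) hγ halive]
        simp only [Subtype.ext_iff]
      · rw [Finset.sum_eq_zero fun j _ => by_contra fun h => halive (hterm j h).2, if_neg]
        rintro rfl
        refine halive ⟨by linarith, ?_⟩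
        rw [add_assoc, ← two_mul]
        exact i'.2
    have hli : LinearIndependent (ZMod 2)
        (fun (i : A) (j : A.biUnion N) => φ i.1.1 j.1) := by
      rw [Fintype.linearIndependent_iff]
      intro a ha
      by_contra! hcon
      -- a row of largest key among those with nonzero coefficient in a linear relation
      obtain ⟨k, hk, hmax⟩ := Finset.exists_max_image ({i | a i ≠ 0} : Finset A)
        (fun i => key i.1) (by simpa [Finset.Nonempty] using hcon)
      rw [Finset.mem_filter] at hk
      refine hk.2 ?_
      have h1 : ∑ i : A, a i * ∑ j ∈ A.biUnion N, φ i.1.1 j * γ j k.1.1 = 0 := by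
        simp only [Finset.mul_sum]
        rw [Finset.sum_comm]
        refine Finset.sum_eq_zero fun j hj => ?_
        have h2 := congrFun ha ⟨j, hj⟩
        simp only [Finset.sum_apply, Pi.smul_apply, smul_eq_mul, Pi.zero_apply] at h2
        simp only [← mul_assoc]
        rw [← Finset.sum_mul, h2, zero_mul]
      rw [Finset.sum_eq_single k] at h1
      · rwa [hentry k.1 k.2 k.1 k.2 le_rfl, if_pos rfl, mul_one] at h1
      · intro i _ hik
        by_cases hai : a i = 0
        · rw [hai, zero_mul]
        · rw [hentry i.1 i.2 k.1 k.2 (hmax i (Finset.mem_filter.2 ⟨Finset.mem_univ _, hai⟩)),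
            if_neg fun h => hik (Subtype.ext h.symm), mul_zero]
      · exact fun h => absurd (Finset.mem_univ _) h
    simpa only [Module.finrank_fintype_fun_eq_card, Fintype.card_coe] using
      hli.fintype_card_le_finrank)
  exact ⟨m, hm, fun i => (Finset.mem_filter.1 (hmN i)).2⟩

theorem MatchCandidate.symm {i : B.ι} {j : C.ι} (h : MatchCandidate f.symm ε C B j i) :
    MatchCandidate f ε B C i j :=
  ⟨h.1.symm, h.2.symm⟩

/-- All bars of length greater than `2 * ε`, on both sides, are covered by a matching of
candidates. -/
theorem exists_matching_matchCandidate (hf : ShiftsSimplices f.toEmbedding ε F G)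
    (hg : ShiftsSimplices f.symm.toEmbedding ε G F) (hε : 0 ≤ ε)
    (B : PersistentBasis F p) (C : PersistentBasis G p) :
    ∃ M : B.ι → C.ι → Prop, (∀ i j, M i j → MatchCandidate f ε B C i j) ∧
      IsEpsMatching B C ε M := by
  obtain ⟨m, hm, hmR⟩ := exists_injective_matchCandidate hf hg hε B C
  obtain ⟨m', hm', hmR'⟩ := exists_injective_matchCandidate (f := f.symm) hg hf hε C B
  obtain ⟨M, h1, h2, h3, h4, h5⟩ := exists_matching_of_partial_injections
    (MatchCandidate f ε B C) _ _ hm hmR hm' (fun j => (hmR' j).symm)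
  exact ⟨M, h1, h2, h3, fun i j h => (h1 i j h).1.1, fun i j h => (h1 i j h).1.2,
    fun i hi hl => hi (h4 i hl), fun j hj hl => hj (h5 j hl)⟩

end PersistentBasis

/-! ### Approximate representatives from the other filtration -/

/-- Let `z` represent a bar of length greater than `2 * ε` in `G`, and let an interval be
`ε`-close to that bar. Then the image of `z` is a `2 * ε`-approximate representative of the
interval in `F`: shifting forth and back changes all relevant times by at most `ε`. -/
theorem pushChain_mem_approxRepresentatives {V W : Type} [Finite W] {F : Filt W} {G : Filt V}
    {p : ℕ} {g : V ≃ W} {ε : ℝ} (hF : HasEntranceTimes F)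
    (hg : ShiftsSimplices g.toEmbedding ε G F) (hf : ShiftsSimplices g.symm.toEmbedding ε F G)
    {b c : ℝ} {d e : WithTop ℝ} (hclose : EpsClose ε b d c e)
    (hlong : ((c + 2 * ε : ℝ) : WithTop ℝ) < e) {z : SChain V} (hz : z ∈ representatives G p c e) :
    pushChain g.toEmbedding z ∈ approxRepresentatives F p (2 * ε) b d := by
  obtain ⟨C, j, rfl, rfl, rfl⟩ := hz
  set z := C.cycle j
  have hback : pushChain g.symm.toEmbedding (pushChain g.toEmbedding z) = z :=
    pushChain_symm_pushChain g z
  have hz0 : z ≠ 0 := by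
    intro h
    exact C.homClass_cycle_ne_zero ⟨le_rfl, C.birth_lt_death j⟩
      (show homClass _ p z = 0 by rw [h, map_zero])
  have hw0 : pushChain g.toEmbedding z ≠ 0 := by
    intro h
    rw [h, map_zero] at hback
    exact hz0 hback.symm
  obtain ⟨b', hb'⟩ := isEntranceSet_cycles hF p hw0
  obtain ⟨d', hd'⟩ := isEntranceSet_boundaries hF p hw0
  simp only [Set.mem_ofPred_eq] at hb' hd'
  have hb1 : b' ≤ ((C.birth j + ε : ℝ) : WithTop ℝ) :=
    (hb' _).1 (hg.pushChain_mem_cycles (C.cycle_mem j))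
  lift b' to ℝ using ne_top_of_le_ne_top WithTop.coe_ne_top hb1
  simp only [WithTop.coe_le_coe] at hb' hb1
  have hb2 : C.birth j ≤ b' + ε := by
    have h := hf.pushChain_mem_cycles ((hb' b').2 le_rfl)
    rw [hback] at h
    exact PersistentBasis.cycle_mem_cycles_iff.1 h
  -- the death of the image, compared with the death of the bar of `z`
  have hd1 : d' ≤ C.death j + (ε : WithTop ℝ) := by
    induction he : C.death j with
    | top => simp
    | coe e =>
      rw [← WithTop.coe_add, ← hd']
      exact hg.pushChain_mem_boundaries (homClass_eq_zero_iff.1 (C.cycle_dead j e he.le))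
  have hd2 : C.death j ≤ d' + (ε : WithTop ℝ) := by
    induction d' with
    | top => simp
    | coe d' =>
      by_contra! hcon
      rw [← WithTop.coe_add] at hcon
      have h := hf.pushChain_mem_boundaries ((hd' d').2 le_rfl)
      rw [hback] at h
      have h1 : d' + ε < C.birth j := by
        by_contra! h1
        exact hcon.not_ge ((C.homClass_cycle_eq_zero_iff h1).1 (homClass_eq_zero_iff.2 h))
      exact C.homClass_cycle_ne_zero ⟨le_rfl, C.birth_lt_death j⟩
        (homClass_eq_zero_iff.2 (boundaries_mono (G.monotone h1.le) p h))
  have hbd : (b' : WithTop ℝ) < d' := by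
    by_contra! h
    have h1 := hlong.trans_le (hd2.trans (add_le_add_left h _))
    rw [← WithTop.coe_add, WithTop.coe_lt_coe] at h1
    linarith
  have hbc := abs_le.1 hclose.1
  refine ⟨b', d', ⟨by linarith [hbc.2], by linarith [hbc.1]⟩, ⟨?_, ?_⟩, hbd, hb', ?_, ?_⟩
  · refine hclose.2.1.trans ((add_le_add_left hd2 _).trans_eq ?_)
    rw [add_assoc, ← WithTop.coe_add, ← two_mul]
  · refine hd1.trans ((add_le_add_left hclose.2.2 _).trans_eq ?_)
    rw [add_assoc, ← WithTop.coe_add, ← two_mul]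
  · -- otherwise the class of `z` would come from a time before the birth of its bar
    rintro s hs ⟨y, hy, hyw⟩
    have h1 := hf.pushChain_mem_boundaries (homClass_eq_iff.1 hyw)
    rw [map_sub, hback] at h1
    refine C.homClass_cycle_notMem_homologyImage (s := s + ε) (t := b' + ε) (i := j)
      (by linarith [hbc.1, hbc.2]) ⟨hb2, ?_⟩ ⟨_, hf.pushChain_mem_cycles hy, homClass_eq_iff.2 h1⟩
    exact lt_of_le_of_lt (WithTop.coe_le_coe.2 (by linarith)) hlong
  · intro s _
    rw [homClass_eq_zero_iff, hd']

/-! ### Perturbations of point sets -/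

section Perturbation

variable {n : ℕ} {P Q : Finset (EuclideanSpace ℝ (Fin n))} {ε : ℝ} {f : P ≃ Q}

theorem IsPerturbation.symm (hf : IsPerturbation ε f) : IsPerturbation ε f.symm := by
  intro y
  have := hf (f.symm y)
  rwa [norm_sub_rev, f.apply_symm_apply] at this

theorem IsPerturbation.dist_le (hf : IsPerturbation ε f) (x : P) :
    dist (x : EuclideanSpace ℝ (Fin n)) (f x) ≤ ε := by
  rw [dist_eq_norm]
  exact hf x

theorem IsPerturbation.shiftsSimplices (hf : IsPerturbation ε f) :
    ShiftsSimplices f.toEmbedding ε (cech P) (cech Q) := by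
  intro s σ hσ
  rw [mem_cech_iff] at hσ ⊢
  obtain ⟨hne, y, hy⟩ := hσ
  refine ⟨hne.map, y, fun x hx => ?_⟩
  obtain ⟨v, hv, rfl⟩ := Finset.mem_map.1 hx
  exact (dist_triangle _ _ _).trans (add_le_add (hy v hv) (hf.dist_le v))

theorem IsPerturbation.chainRadius_pushChain_le (hf : IsPerturbation ε f) (hε : 0 ≤ ε)
    (z : SChain P) :
    chainRadius (pushChain f.toEmbedding z) ≤ chainRadius z + ENNReal.ofReal ε := by
  unfold chainRadius
  rw [ENNReal.sInf_add]
  refine le_iInf₂ fun r hr => ?_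
  obtain ⟨c, δ, rfl, h⟩ := hr
  refine sInf_le ⟨c, δ + ε.toNNReal, by rw [ENNReal.coe_add]; rfl, fun τ hτ x hx => ?_⟩
  obtain ⟨σ, hσ, rfl⟩ := exists_of_mem_support_pushChain _ hτ
  obtain ⟨v, hv, rfl⟩ := Finset.mem_map.1 hx
  have h1 := h σ hσ v hv
  rw [Metric.mem_closedBall] at h1 ⊢
  rw [NNReal.coe_add, Real.coe_toNNReal ε hε, add_comm]
  refine (dist_triangle _ (v : EuclideanSpace ℝ (Fin n)) _).trans (add_le_add ?_ h1)
  rw [dist_comm]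
  exact hf.dist_le v

theorem IsPerturbation.approxBarRadius_le (hf : IsPerturbation ε f) (hε : 0 ≤ ε) (p : ℕ)
    {b c : ℝ} {d e : WithTop ℝ} (hclose : EpsClose ε b d c e)
    (hlong : ((b + 2 * ε : ℝ) : WithTop ℝ) < d) :
    approxBarRadius Q p (2 * ε) c e ≤ barRadius P p b d + ENNReal.ofReal ε := by
  unfold approxBarRadius barRadius
  simp only [ENNReal.iInf_add]
  refine le_iInf₂ fun z hz => ?_
  exact (iInf₂_le _ (pushChain_mem_approxRepresentatives (hasEntranceTimes_cech Q)
    hf.shiftsSimplices hf.symm.shiftsSimplices hclose.symm hlong hz)).trans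
    (hf.chainRadius_pushChain_le hε z)

end Perturbation

theorem mainTheorem1 {n : ℕ} (P Q : Finset (EuclideanSpace ℝ (Fin n))) (ε : ℝ) (hε : 0 ≤ ε)
    (f : P ≃ Q) (hf : IsPerturbation ε f) (p : ℕ) :
    Nonempty (PersistentBasis (cech P) p) ∧ Nonempty (PersistentBasis (cech Q) p) ∧
    ∀ (B : PersistentBasis (cech P) p) (C : PersistentBasis (cech Q) p),
      (∃ M : B.ι → C.ι → Prop, IsInducedMatching f ε B C M) ∧
      ∀ M : B.ι → C.ι → Prop, IsInducedMatching f ε B C M →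
        ∀ (i : B.ι) (j : C.ι), M i j → B.LongerThan (2 * ε) i → C.LongerThan (2 * ε) j →
          approxBarRadius P p (2 * ε) (B.birth i) (B.death i) ≤
              barRadius Q p (C.birth j) (C.death j) + ENNReal.ofReal ε ∧
          approxBarRadius Q p (2 * ε) (C.birth j) (C.death j) ≤
              barRadius P p (B.birth i) (B.death i) + ENNReal.ofReal ε := by
  refine ⟨nonempty_persistentBasis_cech P p, nonempty_persistentBasis_cech Q p,
    fun B C => ⟨?_, fun M hM i j hij hi hj => ?_⟩⟩
  · obtain ⟨M, hM, hmatch⟩ := PersistentBasis.exists_matching_matchCandidate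
      hf.shiftsSimplices hf.symm.shiftsSimplices hε B C
    exact ⟨M, hmatch, fun i j h => (hM i j h).1.interleaved hε, fun i j h => (hM i j h).2⟩
  · have hclose : EpsClose ε (B.birth i) (B.death i) (C.birth j) (C.death j) :=
      ⟨hM.isEpsMatching.birth_close i j hij, hM.isEpsMatching.death_close i j hij⟩
    exact ⟨hf.symm.approxBarRadius_le hε p hclose.symm hj, hf.approxBarRadius_le hε p hclose hi⟩

end
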